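/- Fix $n\ge 2$. Let $\rho_{n-1}$ be the representation of $\operatorname{SL}_2(\mathbb{R})$ on the space $P_{n-1}(\mathbb{R})$ of real homogeneous polynomials of degree $n-1$ in two variables $X,Y$ defined by $$\Big(\rho_{n-1}\begin{pmatrix} a & b\\ c & d\end{pmatrix}P\Big)(X,Y)=P(aX+cY,\;bX+dY),$$ and identify $P_{n-1}(\mathbb{R})$ with $\mathbb{R}^n$ through the basis $X^{n-1},X^{n-2}Y,\dots,XY^{n-2},Y^{n-1}$. The forms with integer coefficients make up a lattice $P_{n-1}(\mathbb{Z})\cong\mathbb{Z}^n$ that is invariant under $\rho_{n-1}(\operatorname{SL}_2(\mathbb{Z}))$, so $\operatorname{SL}_2(\mathbb{Z})$ acts on the torus $\mathbb{T}^n=P_{n-1}(\mathbb{R})/P_{n-1}(\mathbb{Z})=\mathbb{R}^n/\mathbb{Z}^n$, equipped with its normalized Lebesgue measure; for $n$ odd this action factors through $\operatorname{PSL}_2(\mathbb{Z})=\operatorname{SL}_2(\mathbb{Z})/\{\pm 1\}$. Put $G_n=\operatorname{SL}_2(\mathbb{Z})$ if $n$ is even and $G_n=\operatorname{PSL}_2(\mathbb{Z})$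 if $n$ is odd. Then: (i) The action of $G_n$ on $\mathbb{T}^n$ is (measure preserving and) ergodic, and it is essentially free, that is, almost every point of $\mathbb{T}^n$ has trivial stabilizer in $G_n$. (ii) If $n$ is even and $h\in\operatorname{SL}_2(\mathbb{Z})$ is hyperbolic (that is, $|\operatorname{tr} h|>2$, equivalently $h$ has two distinct real eigenvalues), then the cyclic subgroup $\langle h\rangle$ acts ergodically on $\mathbb{T}^n$. -/

import Mathlib

open MeasureTheory
open scoped MatrixGroups

noncomputable section

namespace BinaryForm

/-- The linear change of variables `P(X, Y) ↦ P(aX + cY, bX + dY)` attached to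
`g = (a, b; c, d)`, on polynomials in the two variables `X = X 0` and `Y = X 1`. -/
def subst {R : Type*} [CommRing R] (g : SL(2, R)) :
    MvPolynomial (Fin 2) R →ₐ[R] MvPolynomial (Fin 2) R :=
  MvPolynomial.aeval
    ![MvPolynomial.C (g 0 0) * MvPolynomial.X 0 + MvPolynomial.C (g 1 0) * MvPolynomial.X 1,
      MvPolynomial.C (g 0 1) * MvPolynomial.X 0 + MvPolynomial.C (g 1 1) * MvPolynomial.X 1]

theorem subst_one {R : Type*} [CommRing R] : subst (1 : SL(2, R)) = AlgHom.id R _ := by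
  ext i
  fin_cases i <;> simp [subst]

theorem subst_mul {R : Type*} [CommRing R] (g h : SL(2, R)) :
    subst (g * h) = (subst g).comp (subst h) := by
  apply MvPolynomial.algHom_ext
  intro i
  fin_cases i <;>
  · simp [subst, Matrix.mul_apply, Fin.sum_univ_two, MvPolynomial.algebraMap_eq]
    ring

theorem subst_isHomogeneous {R : Type*} [CommRing R] (g : SL(2, R)) {k : ℕ}
    {P : MvPolynomial (Fin 2) R} (hP : P.IsHomogeneous k) : (subst g P).IsHomogeneous k := by
  have h : (subst g P).IsHomogeneous (1 * k) := by
    refine hP.aeval _ ?_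
    intro i
    fin_cases i <;>
    exact ((MvPolynomial.isHomogeneous_X R _).C_mul _).add
      ((MvPolynomial.isHomogeneous_X R _).C_mul _)
  rw [one_mul] at h
  exact h

/-- The representation `ρ_k` of `SL₂(R)` on the module of binary forms of degree `k`:
`(ρ_k (a, b; c, d) P)(X, Y) = P(aX + cY, bX + dY)`. -/
def rep (R : Type*) [CommRing R] (k : ℕ) :
    Representation R SL(2, R) (MvPolynomial.homogeneousSubmodule (Fin 2) R k) where
  toFun g := (subst g).toLinearMap.restrict fun _ hP => subst_isHomogeneous g hP
  map_one' := by
    ext1 P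
    apply Subtype.ext
    simp [LinearMap.restrict_apply, subst_one]
  map_mul' g h := by
    ext1 P
    apply Subtype.ext
    change subst (g * h) (P : MvPolynomial (Fin 2) R) = subst g (subst h P)
    rw [subst_mul, AlgHom.comp_apply]

/-- The exponent of the monomial `X^(n-1-i) Y^i`. -/
def expo (n : ℕ) (i : Fin n) : Fin 2 →₀ ℕ :=
  Finsupp.single 0 (n - 1 - i) + Finsupp.single 1 (i : ℕ)

theorem expo_injective (n : ℕ) : Function.Injective (expo n) := by
  intro i j h
  have := DFunLike.congr_fun h 1
  simp [expo] at this
  exact Fin.ext this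

theorem degree_expo (n : ℕ) (i : Fin n) : (expo n i).degree = n - 1 := by
  have := i.isLt
  simp [expo, Finsupp.degree_eq_sum, Fin.sum_univ_two]
  omega

theorem exists_expo_eq (n : ℕ) [NeZero n] (d : Fin 2 →₀ ℕ) (hd : d.degree = n - 1) :
    ∃ i, expo n i = d := by
  have hn := NeZero.pos n
  simp only [Finsupp.degree_eq_sum, Fin.sum_univ_two] at hd
  refine ⟨⟨d 1, by omega⟩, ?_⟩
  ext j
  fin_cases j
  · simp [expo]; omega
  · simp [expo]

/-- The canonical basis `X^(n-1), X^(n-2) Y, …, X Y^(n-2), Y^(n-1)` of the binary forms of degree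
`n - 1`. -/
def monomialBasis (R : Type*) [CommRing R] (n : ℕ) [NeZero n] :
    Module.Basis (Fin n) R (MvPolynomial.homogeneousSubmodule (Fin 2) R (n - 1)) :=
  Module.Basis.ofEquivFun
    { toFun := fun P i => MvPolynomial.coeff (expo n i) (P : MvPolynomial (Fin 2) R)
      map_add' := fun P Q => by ext i; simp
      map_smul' := fun r P => by ext i; simp
      invFun := fun c => ⟨∑ i, MvPolynomial.monomial (expo n i) (c i),
        Submodule.sum_mem _ fun i _ =>
          MvPolynomial.isHomogeneous_monomial _ (degree_expo n i)⟩
      left_inv := fun P => by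
        apply Subtype.ext
        ext d
        simp only [MvPolynomial.coeff_sum, MvPolynomial.coeff_monomial]
        by_cases hd : d.degree = n - 1
        · obtain ⟨i, rfl⟩ := exists_expo_eq n d hd
          simp [(expo_injective n).eq_iff]
        · rw [MvPolynomial.IsHomogeneous.coeff_eq_zero
            ((MvPolynomial.mem_homogeneousSubmodule _ _).1 P.2) hd]
          refine Finset.sum_eq_zero fun i _ => if_neg ?_
          rintro rfl
          exact hd (degree_expo n i)
      right_inv := fun c => by
        ext i
        simp [MvPolynomial.coeff_sum, MvPolynomial.coeff_monomial, (expo_injective n).eq_iff] }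

theorem monomialBasis_apply (R : Type*) [CommRing R] (n : ℕ) [NeZero n] (i : Fin n) :
    (monomialBasis R n i : MvPolynomial (Fin 2) R) =
      MvPolynomial.X 0 ^ (n - 1 - (i : ℕ)) * MvPolynomial.X 1 ^ (i : ℕ) := by
  classical
  have h : (monomialBasis R n i : MvPolynomial (Fin 2) R) =
      MvPolynomial.monomial (expo n i) 1 := by
    simp only [monomialBasis, Module.Basis.coe_ofEquivFun]
    change ∑ j, MvPolynomial.monomial (expo n j) ((Pi.single i (1 : R) : Fin n → R) j) = _
    rw [Finset.sum_eq_single i] <;> simp +contextual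
  rw [h, expo, MvPolynomial.X_pow_eq_monomial, MvPolynomial.X_pow_eq_monomial,
    MvPolynomial.monomial_mul, one_mul]

/-- The matrix of `ρ_{n-1}(g)` in the canonical basis. -/
def repMatrix (R : Type*) [CommRing R] (n : ℕ) [NeZero n] (g : SL(2, R)) :
    Matrix (Fin n) (Fin n) R :=
  LinearMap.toMatrix (monomialBasis R n) (monomialBasis R n) (rep R (n - 1) g)

theorem repMatrix_apply (R : Type*) [CommRing R] (n : ℕ) [NeZero n] (g : SL(2, R))
    (i j : Fin n) :
    repMatrix R n g i j = MvPolynomial.coeff (expo n i)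
      (subst g (MvPolynomial.X 0 ^ (n - 1 - (j : ℕ)) * MvPolynomial.X 1 ^ (j : ℕ))) := by
  rw [← monomialBasis_apply R n j, repMatrix, LinearMap.toMatrix_apply]
  rfl

theorem repMatrix_one (R : Type*) [CommRing R] (n : ℕ) [NeZero n] :
    repMatrix R n 1 = 1 := by
  rw [repMatrix, map_one, LinearMap.toMatrix_one]

theorem repMatrix_mul (R : Type*) [CommRing R] (n : ℕ) [NeZero n] (g h : SL(2, R)) :
    repMatrix R n (g * h) = repMatrix R n g * repMatrix R n h := by
  rw [repMatrix, map_mul, LinearMap.toMatrix_mul]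
  rfl

/-- On `SL₂(ℤ)`, the representation over `ℝ` has the integer matrix of the one over `ℤ`. -/
theorem repMatrix_map (n : ℕ) [NeZero n] (g : SL(2, ℤ)) :
    repMatrix ℝ n (Matrix.SpecialLinearGroup.map (Int.castRingHom ℝ) g) =
      (repMatrix ℤ n g).map (fun m : ℤ => (m : ℝ)) := by
  ext i j
  rw [Matrix.map_apply, repMatrix_apply, repMatrix_apply, ← eq_intCast (Int.castRingHom ℝ),
    ← MvPolynomial.coeff_map]
  simp [subst]

/-- The linear action of `SL₂(ℤ)` on `𝕋ⁿ = ℝⁿ / ℤⁿ`, where `ℝⁿ` is the space of real binary forms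
of degree `n - 1` (in the canonical basis) and `ℤⁿ` is the lattice of integral forms. -/
instance torusAction (n : ℕ) [NeZero n] : MulAction SL(2, ℤ) (UnitAddTorus (Fin n)) where
  smul g x := fun i => ∑ j, repMatrix ℤ n g i j • x j
  one_smul x := by
    funext i
    change ∑ j, repMatrix ℤ n 1 i j • x j = x i
    simp [repMatrix_one, Matrix.one_apply]
  mul_smul g h x := by
    funext i
    change ∑ j, repMatrix ℤ n (g * h) i j • x j =
      ∑ j, repMatrix ℤ n g i j • ∑ l, repMatrix ℤ n h j l • x l
    simp only [repMatrix_mul, Matrix.mul_apply, Finset.sum_smul, Finset.smul_sum, mul_smul]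
    exact Finset.sum_comm

theorem torus_smul_apply (n : ℕ) [NeZero n] (g : SL(2, ℤ)) (x : UnitAddTorus (Fin n))
    (i : Fin n) : (g • x) i = ∑ j, repMatrix ℤ n g i j • x j := rfl

/-- The action on the torus is induced by the real representation `ρ_{n-1}`: the quotient map from
the real binary forms of degree `n - 1` to the torus is equivariant. -/
theorem torus_smul_mk (n : ℕ) [NeZero n] (g : SL(2, ℤ))
    (P : MvPolynomial.homogeneousSubmodule (Fin 2) ℝ (n - 1)) :
    g • (fun i => (((monomialBasis ℝ n).repr P i : ℝ) : UnitAddCircle) : UnitAddTorus (Fin n)) =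
      fun i => (((monomialBasis ℝ n).repr
        (rep ℝ (n - 1) (Matrix.SpecialLinearGroup.map (Int.castRingHom ℝ) g) P) i : ℝ) :
          UnitAddCircle) := by
  funext i
  rw [torus_smul_apply, ← LinearMap.toMatrix_mulVec_repr (monomialBasis ℝ n) (monomialBasis ℝ n)]
  change _ = (((repMatrix ℝ n _).mulVec _ i : ℝ) : UnitAddCircle)
  rw [repMatrix_map]
  simp only [Matrix.mulVec, dotProduct, Matrix.map_apply]
  have h : ∀ f : Fin n → ℝ, ((∑ j, f j : ℝ) : UnitAddCircle) = ∑ j, ((f j : ℝ) : UnitAddCircle) :=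
    fun f => map_sum (QuotientAddGroup.mk' (AddSubgroup.zmultiples (1 : ℝ))) f Finset.univ
  rw [h]
  refine Finset.sum_congr rfl fun j _ => ?_
  rw [← zsmul_eq_mul, AddCircle.coe_zsmul]

theorem rep_eq_one_of_mem_center (R : Type*) [CommRing R] {k : ℕ} (hk : Even k) (g : SL(2, R))
    (hg : g ∈ Subgroup.center SL(2, R)) : rep R k g = 1 := by
  obtain ⟨r, hr, hgr⟩ := Matrix.SpecialLinearGroup.mem_center_iff.1 hg
  rw [Fintype.card_fin] at hr
  ext1 P
  apply Subtype.ext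
  change subst g (P : MvPolynomial (Fin 2) R) = P
  have hP : (P : MvPolynomial (Fin 2) R).IsHomogeneous k :=
    (MvPolynomial.mem_homogeneousSubmodule _ _).1 P.2
  have hs : subst g = MvPolynomial.aeval
      fun i : Fin 2 => MvPolynomial.C r * (MvPolynomial.X i : MvPolynomial (Fin 2) R) := by
    apply MvPolynomial.algHom_ext
    intro i
    fin_cases i <;> simp [subst, ← hgr]
  have hrk : r ^ k = 1 := by
    obtain ⟨m, rfl⟩ := hk
    rw [← two_mul, pow_mul, hr, one_pow]
  rw [hs]
  conv_lhs => rw [(P : MvPolynomial (Fin 2) R).as_sum]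
  conv_rhs => rw [(P : MvPolynomial (Fin 2) R).as_sum]
  rw [map_sum]
  refine Finset.sum_congr rfl fun d hd => ?_
  have hdk : d 0 + d 1 = k := by
    have h := hP (MvPolynomial.mem_support_iff.1 hd)
    rw [← h, Finsupp.weight_apply, Finsupp.sum_fintype _ _ (by simp)]
    simp [Fin.sum_univ_two]
  rw [MvPolynomial.aeval_monomial, MvPolynomial.monomial_eq,
    Finsupp.prod_fintype _ _ (by simp), Finsupp.prod_fintype _ _ (by simp)]
  simp only [Fin.prod_univ_two, mul_pow, MvPolynomial.algebraMap_eq]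
  have hC : (MvPolynomial.C r : MvPolynomial (Fin 2) R) ^ d 0 * MvPolynomial.C r ^ d 1 = 1 := by
    rw [← pow_add, hdk, ← map_pow, hrk, map_one]
  linear_combination (MvPolynomial.C (MvPolynomial.coeff d (P : MvPolynomial (Fin 2) R)) *
    MvPolynomial.X 0 ^ d 0 * MvPolynomial.X 1 ^ d 1) * hC

theorem torus_smul_eq_of_mem_center (n : ℕ) [NeZero n] (hn : Odd n) (g : SL(2, ℤ))
    (hg : g ∈ Subgroup.center SL(2, ℤ)) (x : UnitAddTorus (Fin n)) : g • x = x := by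
  have hk : Even (n - 1) := by
    obtain ⟨m, rfl⟩ := hn
    simp
  funext i
  rw [torus_smul_apply, repMatrix, rep_eq_one_of_mem_center ℤ hk g hg, LinearMap.toMatrix_one]
  simp [Matrix.one_apply]

/-- For odd `n`, the action of `SL₂(ℤ)` on `𝕋ⁿ` factors through
`PSL₂(ℤ) = SL₂(ℤ) / center = SL₂(ℤ) / {±1}`. -/
instance torusActionPSL (n : ℕ) [NeZero n] [hn : Fact (Odd n)] :
    MulAction (Matrix.ProjectiveSpecialLinearGroup (Fin 2) ℤ) (UnitAddTorus (Fin n)) :=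
  MulAction.compHom (UnitAddTorus (Fin n))
    (QuotientGroup.lift (Subgroup.center SL(2, ℤ))
      (MulAction.toPermHom SL(2, ℤ) (UnitAddTorus (Fin n)))
      fun g hg => Equiv.ext fun x => torus_smul_eq_of_mem_center n hn.out g hg x)

theorem psl_smul_mk (n : ℕ) [NeZero n] [Fact (Odd n)] (g : SL(2, ℤ))
    (x : UnitAddTorus (Fin n)) :
    (g : Matrix.ProjectiveSpecialLinearGroup (Fin 2) ℤ) • x = g • x := rfl

end BinaryForm

/-- An action of a group `G` on a measure space is essentially free if almost every point has
trivial stabilizer. -/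
def EssentiallyFree (G : Type*) {X : Type*} [Group G] [MulAction G X] [MeasurableSpace X]
    (μ : Measure X) : Prop :=
  ∀ᵐ x ∂μ, MulAction.stabilizer G x = ⊥

end

/-!
The action of an integer matrix `A` on the torus `ℝᵈ / ℤᵈ` sends the character of frequency `k` to
the character of frequency `k A`. The Fourier coefficients of an almost invariant set are therefore
constant along the orbits of the dual action on `ℤᵈ`; being square summable, they vanish on infinite
orbits. So an action by toral automorphisms is ergodic as soon as every nonzero `k` has an infinite
dual orbit (`ergodicSMul_of_infinite_dual_orbits`). It is essentially free as soon as no nontrivial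
element acts by the identity matrix, because for `A ≠ 1` the fixed points of `A` lie in the kernel of
a nontrivial character, which is a null set (`essentiallyFree_of_toralMap`).

What remains is linear algebra of the representation on binary forms of degree `n - 1`. It maps the
power `(xX + yY)^(n-1)` to the power of the linear form with coefficient vector `g (x, y)`
(`repMatrix_mulVec_powerVec`).

* If `k` has a finite dual orbit under `SL₂(ℤ)`, then the pairings of `k` with `(X + tY)^(n-1)` and
  with `(tX + Y)^(n-1)`, which are polynomials in `t`, take a single value for infinitely many
  integers `t`. Hence they are constant, and comparing coefficients gives `k = 0`
  (`eq_zero_of_infinite_unipotent`).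
* A hyperbolic element is conjugate in `SL₂(ℝ)` to `diag(r, r⁻¹)` with `|r| ≠ 1`, and acts on binary
  forms with eigenvalues `r^(n-1-2i)`. For `n` even the exponents are odd, no eigenvalue has absolute
  value `1`, and all nonzero dual orbits are infinite (`infinite_dual_orbit_of_isHyperbolic`).
* Only scalar matrices act trivially (`entries_of_repMatrix_eq_one`), and `-1` acts nontrivially when
  `n - 1` is odd.
-/

/-! ### Fourier coefficients on the torus -/

section Fourier

variable {d : Type*} [Fintype d]

/-- The Lebesgue measure of the torus is the product of the normalised Haar measures used in
Mathlib's Fourier theory, which come from a different `MeasureSpace` instance on the circle. -/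
theorem volume_unitAddTorus_eq :
    (volume : Measure (UnitAddTorus d)) = Measure.pi fun _ => AddCircle.haarAddCircle := by
  have h : (volume : Measure UnitAddCircle) = AddCircle.haarAddCircle := by
    rw [AddCircle.volume_eq_smul_haarAddCircle]; simp
  rw [volume_pi, h]

instance isProbabilityMeasure_volume_unitAddTorus :
    IsProbabilityMeasure (volume : Measure (UnitAddTorus d)) := by
  rw [volume_unitAddTorus_eq]; infer_instance

theorem summable_sq_norm_integral_mFourier {f : UnitAddTorus d → ℂ} (hf : MemLp f 2 volume) :
    Summable fun k : d → ℤ => ‖∫ x, UnitAddTorus.mFourier (-k) x * f x‖ ^ 2 := by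
  rw [volume_unitAddTorus_eq] at hf ⊢
  have h := (UnitAddTorus.hasSum_sq_mFourierCoeff hf.toLp).summable
  convert h using 4 with k
  refine integral_congr_ae ?_
  filter_upwards [hf.coeFn_toLp] with x hx
  rw [smul_eq_mul]
  exact congrArg _ hx.symm

theorem ae_eq_const_of_integral_mFourier_eq_zero {f : UnitAddTorus d → ℂ} (hf : MemLp f 2 volume)
    (h : ∀ k : d → ℤ, k ≠ 0 → ∫ x, UnitAddTorus.mFourier (-k) x * f x = 0) :
    ∃ c : ℂ, ∀ᵐ x, f x = c := by
  rw [volume_unitAddTorus_eq] at hf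
  simp only [volume_unitAddTorus_eq] at h ⊢
  have hs := UnitAddTorus.hasSum_mFourier_series_L2 hf.toLp
  have hk : ∀ k, k ≠ 0 → UnitAddTorus.mFourierCoeff hf.toLp k = 0 := by
    intro k hk
    rw [← h k hk]
    refine integral_congr_ae ?_
    filter_upwards [hf.coeFn_toLp] with x hx
    rw [smul_eq_mul]
    exact congrArg _ hx
  have h0 := hs.unique (hasSum_single 0 fun k hk0 => by rw [hk k hk0, zero_smul])
  refine ⟨UnitAddTorus.mFourierCoeff hf.toLp 0, ?_⟩
  filter_upwards [hf.coeFn_toLp, UnitAddTorus.coeFn_mFourierLp (d := d) 2 0,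
    Lp.coeFn_smul (UnitAddTorus.mFourierCoeff hf.toLp 0) (UnitAddTorus.mFourierLp (d := d) 2 0)]
    with x h1 h2 h3
  rw [← h1]
  refine (congrArg (fun g : Lp ℂ 2 (Measure.pi fun _ : d => AddCircle.haarAddCircle) => g x)
    h0).trans (h3.trans ?_)
  rw [Pi.smul_apply, h2, UnitAddTorus.mFourier_zero]
  simp

end Fourier

/-! ### Ergodicity of families of toral endomorphisms -/

section Toral

open scoped Matrix

variable {d : Type*} [Fintype d]

/-- The endomorphism of the torus induced by an integer matrix. -/
def toralMap (A : Matrix d d ℤ) : UnitAddTorus d →+ UnitAddTorus d where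
  toFun x i := ∑ j, A i j • x j
  map_zero' := by ext i; simp
  map_add' x y := by ext i; simp [Finset.sum_add_distrib]

theorem toralMap_apply (A : Matrix d d ℤ) (x : UnitAddTorus d) (i : d) :
    toralMap A x i = ∑ j, A i j • x j := rfl

theorem continuous_toralMap (A : Matrix d d ℤ) : Continuous (toralMap A) :=
  continuous_pi fun i => continuous_finsetSum _ fun j _ => (continuous_apply j).zsmul (A i j)

theorem measurePreserving_toralMap {A : Matrix d d ℤ} (hA : Function.Surjective (toralMap A)) :
    MeasurePreserving (toralMap A) :=
  AddMonoidHom.measurePreserving (continuous_toralMap A) hA rfl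

theorem mFourier_toralMap (A : Matrix d d ℤ) (k : d → ℤ) (x : UnitAddTorus d) :
    UnitAddTorus.mFourier k (toralMap A x) = UnitAddTorus.mFourier (k ᵥ* A) x := by
  have h : ∀ (m : d → ℤ) (y : UnitAddTorus d),
      UnitAddTorus.mFourier m y = ((∑ i, m i • y i : UnitAddCircle).toCircle : ℂ) := by
    intro m y
    classical
    have hsum : ∀ s : Finset d, ((∑ i ∈ s, m i • y i : UnitAddCircle).toCircle : ℂ) =
        ∏ i ∈ s, fourier (m i) (y i) := by
      intro s
      induction s using Finset.induction_on with
      | empty => simp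
      | insert a s ha ih =>
        rw [Finset.sum_insert ha, Finset.prod_insert ha, AddCircle.toCircle_add, Circle.coe_mul,
          ih, fourier_apply]
    exact (hsum Finset.univ).symm
  rw [h, h]
  congr 2
  simp only [toralMap_apply, Matrix.vecMul, dotProduct, Finset.sum_smul, Finset.smul_sum, mul_smul]
  exact Finset.sum_comm

/-- A set that is almost invariant under a family of surjective toral endomorphisms is null or
conull as soon as every nonzero character has an infinite orbit under the dual family: the Fourier
coefficients of its indicator are constant on orbits and square summable. -/
theorem eventuallyConst_of_infinite_dual_orbits {s : Set (UnitAddTorus d)} (hs : MeasurableSet s)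
    (𝒜 : Set (Matrix d d ℤ)) (hsurj : ∀ A ∈ 𝒜, Function.Surjective (toralMap A))
    (hinv : ∀ A ∈ 𝒜, toralMap A ⁻¹' s =ᵐ[volume] s)
    (horb : ∀ k : d → ℤ, k ≠ 0 → ((fun A => k ᵥ* A) '' 𝒜).Infinite) :
    Filter.EventuallyConst s (ae volume) := by
  classical
  set f : UnitAddTorus d → ℂ := s.indicator 1 with hf
  have hfL : MemLp f 2 volume := memLp_indicator_const 2 hs 1 (Or.inr (measure_ne_top _ _))
  have hinvf : ∀ A ∈ 𝒜, ∀ k : d → ℤ, ∫ x, UnitAddTorus.mFourier (-(k ᵥ* A)) x * f x =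
      ∫ x, UnitAddTorus.mFourier (-k) x * f x := by
    intro A hA k
    have hmp := measurePreserving_toralMap (hsurj A hA)
    have hmeas : AEStronglyMeasurable (fun x => UnitAddTorus.mFourier (-k) x * f x) volume :=
      (ContinuousMap.continuous _).aestronglyMeasurable.mul hfL.1
    have hmap := integral_map hmp.measurable.aemeasurable (hmp.map_eq.symm ▸ hmeas)
    rw [hmp.map_eq] at hmap
    rw [hmap]
    refine integral_congr_ae ?_
    filter_upwards [hinv A hA] with x hx
    have hx' : (toralMap A x ∈ s) = (x ∈ s) := hx
    simp only [mFourier_toralMap, Matrix.neg_vecMul, hf, Set.indicator_apply, hx', Pi.one_apply]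
  have hzero : ∀ k : d → ℤ, k ≠ 0 → ∫ x, UnitAddTorus.mFourier (-k) x * f x = 0 := by
    intro k hk
    by_contra hne
    have hpos : 0 < ‖∫ x, UnitAddTorus.mFourier (-k) x * f x‖ ^ 2 := by positivity
    have hfin := (summable_sq_norm_integral_mFourier hfL).tendsto_cofinite_zero.eventually
      (gt_mem_nhds hpos)
    refine horb k hk (Set.Finite.subset hfin ?_)
    rintro _ ⟨A, hA, rfl⟩
    simp [hinvf A hA k]
  obtain ⟨c, hc⟩ := ae_eq_const_of_integral_mFourier_eq_zero hfL hzero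
  rw [Filter.eventuallyConst_set]
  by_cases h1 : c = 1
  · left
    filter_upwards [hc] with x hx
    by_contra hxs
    simp [hf, hxs, h1] at hx
  · right
    filter_upwards [hc] with x hx hxs
    exact h1 (by simpa [hf, hxs] using hx.symm)

/-- The kernel of a nontrivial character of the torus is a null set: the character pushes the
Lebesgue measure forward to the Lebesgue measure of the circle, which has no atoms. -/
theorem volume_sum_zsmul_eq_zero {c : d → ℤ} (hc : c ≠ 0) :
    volume {x : UnitAddTorus d | ∑ j, c j • x j = 0} = 0 := by
  classical
  obtain ⟨j, hj⟩ := Function.ne_iff.1 hc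
  let φ : UnitAddTorus d →+ UnitAddCircle :=
    { toFun := fun x => ∑ j, c j • x j
      map_zero' := by simp
      map_add' := fun x y => by simp [Finset.sum_add_distrib] }
  have hφ : Continuous φ :=
    continuous_finsetSum _ fun j _ => (continuous_apply j).zsmul (c j)
  have hsurj : Function.Surjective φ := by
    intro y
    refine ⟨Pi.single j (DivisibleBy.div y (c j)), ?_⟩
    change ∑ i, c i • (Pi.single j (DivisibleBy.div y (c j)) : UnitAddTorus d) i = y
    rw [Finset.sum_eq_single j]
    · rw [Pi.single_eq_same]; exact DivisibleBy.div_cancel y hj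
    · intro i _ hi; rw [Pi.single_eq_of_ne hi, smul_zero]
    · simp
  have hmp : MeasurePreserving φ volume volume :=
    AddMonoidHom.measurePreserving hφ hsurj (by simp)
  change volume (φ ⁻¹' {0}) = 0
  rw [hmp.measure_preimage (measurableSet_singleton 0).nullMeasurableSet, ← Metric.closedBall_zero,
    AddCircle.volume_closedBall]
  simp

theorem ae_toralMap_ne [DecidableEq d] {A : Matrix d d ℤ} (hA : A ≠ 1) :
    ∀ᵐ x, toralMap A x ≠ x := by
  obtain ⟨i, hi⟩ := Function.ne_iff.1 (sub_ne_zero.2 hA)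
  refine measure_mono_null ?_ (volume_sum_zsmul_eq_zero hi)
  intro x hx
  have hxi : ∑ j, A i j • x j = x i := congrFun (not_not.1 hx) i
  change ∑ j, (A i j - (1 : Matrix d d ℤ) i j) • x j = 0
  simp [sub_smul, Finset.sum_sub_distrib, Matrix.one_apply, hxi]

/-- A group acting by toral automorphisms acts ergodically if some family of matrices through which
it acts moves every nonzero character along an infinite orbit. -/
theorem ergodicSMul_of_infinite_dual_orbits {G : Type*} [Group G] [MulAction G (UnitAddTorus d)]
    (hG : ∀ g : G, ∃ A : Matrix d d ℤ, ∀ x : UnitAddTorus d, g • x = toralMap A x)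
    (𝒜 : Set (Matrix d d ℤ)) (h𝒜 : ∀ A ∈ 𝒜, ∃ g : G, ∀ x : UnitAddTorus d, g • x = toralMap A x)
    (horb : ∀ k : d → ℤ, k ≠ 0 → ((fun A => k ᵥ* A) '' 𝒜).Infinite) :
    ErgodicSMul G (UnitAddTorus d) (volume : Measure (UnitAddTorus d)) where
  measure_preimage_smul g s hs := by
    obtain ⟨A, hA⟩ := hG g
    have hsurj : Function.Surjective (toralMap A) := fun x => ⟨g⁻¹ • x, by rw [← hA]; simp⟩
    simp only [hA]
    exact (measurePreserving_toralMap hsurj).measure_preimage hs.nullMeasurableSet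
  aeconst_of_forall_preimage_smul_ae_eq {s} hs hinv := by
    refine eventuallyConst_of_infinite_dual_orbits hs 𝒜 (fun A hA x => ?_) (fun A hA => ?_) horb
    · obtain ⟨g, hg⟩ := h𝒜 A hA
      exact ⟨g⁻¹ • x, by rw [← hg]; simp⟩
    · obtain ⟨g, hg⟩ := h𝒜 A hA
      simpa only [hg] using hinv g

theorem essentiallyFree_of_toralMap [DecidableEq d] {G : Type*} [Group G] [Countable G]
    [MulAction G (UnitAddTorus d)]
    (hG : ∀ g : G, g ≠ 1 → ∃ A : Matrix d d ℤ, A ≠ 1 ∧ ∀ x : UnitAddTorus d,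
      g • x = toralMap A x) :
    EssentiallyFree G (volume : Measure (UnitAddTorus d)) := by
  have h : ∀ᵐ x : UnitAddTorus d, ∀ g : G, g ≠ 1 → g • x ≠ x := by
    rw [ae_all_iff]
    intro g
    by_cases hg : g = 1
    · simp [hg]
    · obtain ⟨A, hA, hgA⟩ := hG g hg
      filter_upwards [ae_toralMap_ne hA] with x hx _
      rwa [hgA]
  filter_upwards [h] with x hx
  rw [eq_bot_iff]
  intro g hg
  by_contra hne
  exact hx g hne hg

end Toral

/-! ### Matrices of the representations on binary forms -/

namespace BinaryForm

open scoped Matrix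

section CommRing

variable {R : Type*} [CommRing R] {n : ℕ}

/-- The coefficients of the power `(xX + yY)^(n-1)` in the canonical basis of the binary forms of
degree `n - 1`. -/
def powerVec (n : ℕ) (x y : R) (i : Fin n) : R :=
  x ^ (n - 1 - (i : ℕ)) * y ^ (i : ℕ) * ((n - 1).choose i : R)

variable [NeZero n]

theorem coe_monomialBasis_equivFun_symm_powerVec (x y : R) :
    ((monomialBasis R n).equivFun.symm (powerVec n x y) : MvPolynomial (Fin 2) R) =
      (MvPolynomial.C x * MvPolynomial.X 0 + MvPolynomial.C y * MvPolynomial.X 1) ^ (n - 1) := by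
  have hn : n - 1 + 1 = n := Nat.sub_add_cancel (NeZero.pos n)
  rw [Module.Basis.equivFun_symm_apply, Submodule.coe_sum, add_comm (MvPolynomial.C x * _),
    add_pow, hn, ← Fin.sum_univ_eq_sum_range (fun m => (MvPolynomial.C y * MvPolynomial.X 1) ^ m *
      (MvPolynomial.C x * MvPolynomial.X 0) ^ (n - 1 - m) * (((n - 1).choose m : ℕ) :
        MvPolynomial (Fin 2) R)) n]
  refine Finset.sum_congr rfl fun i _ => ?_
  rw [Submodule.coe_smul, monomialBasis_apply, MvPolynomial.smul_eq_C_mul]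
  simp only [powerVec, map_mul, map_pow, map_natCast, mul_pow]
  ring

/-- The representation maps the `(n-1)`-st power of the linear form with coefficient vector `v` to
that of the linear form with coefficient vector `g v`. -/
theorem repMatrix_mulVec_powerVec (g : SL(2, R)) (x y : R) :
    repMatrix R n g *ᵥ powerVec n x y =
      powerVec n (g 0 0 * x + g 0 1 * y) (g 1 0 * x + g 1 1 * y) := by
  have h : rep R (n - 1) g ((monomialBasis R n).equivFun.symm (powerVec n x y)) =
      (monomialBasis R n).equivFun.symm
        (powerVec n (g 0 0 * x + g 0 1 * y) (g 1 0 * x + g 1 1 * y)) := by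
    apply Subtype.ext
    change subst g _ = _
    refine (congrArg (subst g) (coe_monomialBasis_equivFun_symm_powerVec x y)).trans
      (Eq.trans ?_ (coe_monomialBasis_equivFun_symm_powerVec _ _).symm)
    simp only [subst, map_pow, map_add, map_mul, MvPolynomial.aeval_X, MvPolynomial.aeval_C,
      MvPolynomial.algebraMap_eq, Matrix.cons_val_zero, Matrix.cons_val_one]
    ring
  have h2 := LinearMap.toMatrix_mulVec_repr (monomialBasis R n) (monomialBasis R n)
    (rep R (n - 1) g) ((monomialBasis R n).equivFun.symm (powerVec n x y))
  rw [h] at h2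
  simpa only [repMatrix, ← Module.Basis.equivFun_apply, LinearEquiv.apply_symm_apply] using h2

theorem repMatrix_pow (g : SL(2, R)) (m : ℕ) : repMatrix R n (g ^ m) = repMatrix R n g ^ m := by
  induction m with
  | zero => simp [repMatrix_one]
  | succ m ih => rw [pow_succ, pow_succ, repMatrix_mul, ih]

theorem repMatrix_of_diagonal {g : SL(2, R)} (h01 : g 0 1 = 0) (h10 : g 1 0 = 0) :
    repMatrix R n g =
      Matrix.diagonal fun i : Fin n => g 0 0 ^ (n - 1 - (i : ℕ)) * g 1 1 ^ (i : ℕ) := by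
  ext i j
  have h : subst g (MvPolynomial.X 0 ^ (n - 1 - (j : ℕ)) * MvPolynomial.X 1 ^ (j : ℕ)) =
      MvPolynomial.monomial (expo n j) (g 0 0 ^ (n - 1 - (j : ℕ)) * g 1 1 ^ (j : ℕ)) := by
    rw [← mul_one (_ * _ : R), ← MvPolynomial.C_mul_monomial]
    have hX : (MvPolynomial.monomial (expo n j) (1 : R)) =
        MvPolynomial.X 0 ^ (n - 1 - (j : ℕ)) * MvPolynomial.X 1 ^ (j : ℕ) := by
      rw [expo, MvPolynomial.X_pow_eq_monomial, MvPolynomial.X_pow_eq_monomial,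
        MvPolynomial.monomial_mul, one_mul]
    rw [hX]
    simp [subst, h01, h10, mul_pow]
    ring
  rw [repMatrix_apply, h, MvPolynomial.coeff_monomial, Matrix.diagonal_apply]
  by_cases hij : i = j
  · subst hij; simp
  · rw [if_neg hij, if_neg fun h' => hij (expo_injective n h').symm]

end CommRing

variable {n : ℕ} [NeZero n]

/-- The kernel of the representation on forms of positive degree consists of scalar matrices. -/
theorem entries_of_repMatrix_eq_one (hn : 2 ≤ n) {g : SL(2, ℤ)} (hg : repMatrix ℤ n g = 1) :
    g 0 1 = 0 ∧ g 1 0 = 0 ∧ g 0 0 ^ (n - 1) = 1 ∧ g 1 1 ^ (n - 1) = 1 := by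
  have hN : n - 1 ≠ 0 := by omega
  have h1 := repMatrix_mulVec_powerVec (n := n) g 1 0
  have h2 := repMatrix_mulVec_powerVec (n := n) g 0 1
  rw [hg, Matrix.one_mulVec] at h1 h2
  have h10 := congrFun h1 ⟨0, by omega⟩
  have h1N := congrFun h1 ⟨n - 1, by omega⟩
  have h20 := congrFun h2 ⟨0, by omega⟩
  have h2N := congrFun h2 ⟨n - 1, by omega⟩
  simp [powerVec, hN] at h10 h1N h20 h2N
  exact ⟨eq_zero_of_pow_eq_zero h20.symm, eq_zero_of_pow_eq_zero h1N.symm, h10.symm, h2N.symm⟩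

/-! ### Dual orbits of unipotent elements -/

/-- The lower unipotent matrix with off-diagonal entry `t`. -/
def lowerUnipotent (t : ℤ) : SL(2, ℤ) := ⟨!![1, 0; t, 1], by simp⟩

/-- The upper unipotent matrix with off-diagonal entry `t`. -/
def upperUnipotent (t : ℤ) : SL(2, ℤ) := ⟨!![1, t; 0, 1], by simp⟩

theorem repMatrix_lowerUnipotent_mulVec (t : ℤ) :
    repMatrix ℤ n (lowerUnipotent t) *ᵥ powerVec n 1 0 = powerVec n 1 t := by
  rw [repMatrix_mulVec_powerVec]
  simp [lowerUnipotent]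

theorem repMatrix_upperUnipotent_mulVec (t : ℤ) :
    repMatrix ℤ n (upperUnipotent t) *ᵥ powerVec n 0 1 = powerVec n t 1 := by
  rw [repMatrix_mulVec_powerVec]
  simp [upperUnipotent]

/-- The lower and upper unipotent subgroups together have no nonzero integral covector with finite
orbits: the pairing with the powers `(X + tY)^(n-1)` and `(tX + Y)^(n-1)` is polynomial in `t`. -/
theorem eq_zero_of_infinite_unipotent (hn : 2 ≤ n) {k v v' : Fin n → ℤ}
    (hl : {t : ℤ | k ᵥ* repMatrix ℤ n (lowerUnipotent t) = v}.Infinite)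
    (hu : {t : ℤ | k ᵥ* repMatrix ℤ n (upperUnipotent t) = v'}.Infinite) : k = 0 := by
  have hN : n - 1 ≠ 0 := by omega
  have hpos : ∀ i : Fin n, (i : ℕ) ≠ 0 → k i = 0 := by
    intro i hi
    let p : Polynomial ℤ := ∑ j : Fin n, Polynomial.C (k j * ((n - 1).choose j : ℤ)) *
      Polynomial.X ^ (j : ℕ)
    have hp : p = Polynomial.C (v ⬝ᵥ powerVec n 1 0) := by
      refine Polynomial.eq_of_infinite_eval_eq _ _ (hl.mono fun t ht => ?_)
      simp only [Set.mem_ofPred_eq] at ht ⊢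
      rw [← ht, ← Matrix.dotProduct_mulVec, repMatrix_lowerUnipotent_mulVec]
      simp [p, Polynomial.eval_finsetSum, dotProduct, powerVec]
      exact Finset.sum_congr rfl fun j _ => by ring
    have hc := congrArg (fun q => Polynomial.coeff q (i : ℕ)) hp
    simp only [p, Polynomial.finsetSum_coeff, Polynomial.coeff_C_mul_X_pow,
      Polynomial.coeff_C, if_neg hi, Fin.val_inj] at hc
    have hch : (n - 1).choose i ≠ 0 := (Nat.choose_pos (by omega)).ne'
    simpa [hch] using hc
  have hzero : k ⟨0, by omega⟩ = 0 := by
    have hp : Polynomial.C (k ⟨0, by omega⟩) * Polynomial.X ^ (n - 1) =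
        Polynomial.C (v' ⬝ᵥ powerVec n 0 1) := by
      refine Polynomial.eq_of_infinite_eval_eq _ _ (hu.mono fun t ht => ?_)
      simp only [Set.mem_ofPred_eq] at ht ⊢
      rw [← ht, ← Matrix.dotProduct_mulVec, repMatrix_upperUnipotent_mulVec, dotProduct,
        Finset.sum_eq_single ⟨0, by omega⟩]
      · simp [powerVec]
      · intro j _ hj
        rw [hpos j fun h => hj (Fin.ext h), zero_mul]
      · simp
    have hc := congrArg (fun q => Polynomial.coeff q (n - 1)) hp
    rwa [Polynomial.coeff_C_mul_X_pow, if_pos rfl, Polynomial.coeff_C, if_neg hN] at hc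
  funext i
  by_cases hi : (i : ℕ) = 0
  · exact (congrArg k (Fin.ext hi)).trans hzero
  · exact hpos i hi

theorem infinite_dual_orbit_specialLinearGroup (hn : 2 ≤ n) {k : Fin n → ℤ} (hk : k ≠ 0) :
    ((fun A => k ᵥ* A) '' Set.range (repMatrix ℤ n)).Infinite := by
  intro hfin
  -- A finite orbit forces the covector to be constant along infinitely many parameters `t`.
  have key : ∀ u : ℤ → SL(2, ℤ), ∃ v, {t : ℤ | k ᵥ* repMatrix ℤ n (u t) = v}.Infinite := by
    intro u
    have := hfin.to_subtype
    obtain ⟨v, hv⟩ := Finite.exists_infinite_fiber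
      (fun t : ℤ => (⟨k ᵥ* repMatrix ℤ n (u t), _, ⟨u t, rfl⟩, rfl⟩ :
        ((fun A => k ᵥ* A) '' Set.range (repMatrix ℤ n))))
    refine ⟨v, (Set.infinite_coe_iff.1 hv).mono fun t ht => ?_⟩
    exact congrArg Subtype.val ht
  obtain ⟨v, hv⟩ := key lowerUnipotent
  obtain ⟨v', hv'⟩ := key upperUnipotent
  exact hk (eq_zero_of_infinite_unipotent hn hv hv')

/-! ### Dual orbits of hyperbolic elements -/

/-- A hyperbolic integral matrix is conjugate in `SL₂(ℝ)` to a diagonal matrix `q` with distinct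
diagonal entries. Conjugating inside `SL₂(ℝ)`, and not only in `GL₂(ℝ)`, is what allows the
representation to be applied to the conjugating matrix `p`. -/
theorem exists_diagonalization_of_isHyperbolic {h : SL(2, ℤ)}
    (hh : (h : Matrix (Fin 2) (Fin 2) ℤ).IsHyperbolic) :
    ∃ (p q : SL(2, ℝ)), q 0 1 = 0 ∧ q 1 0 = 0 ∧ q 0 0 ≠ q 1 1 ∧
      Matrix.SpecialLinearGroup.map (Int.castRingHom ℝ) h * p = p * q := by
  have hdet : h 0 0 * h 1 1 - h 0 1 * h 1 0 = 1 := by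
    rw [← Matrix.det_fin_two, h.det_coe]
  have hdisc : 4 < (h 0 0 + h 1 1) ^ 2 := by
    have := hh
    rw [Matrix.IsHyperbolic, Matrix.discr_fin_two, h.det_coe, Matrix.trace_fin_two] at this
    linarith
  -- If the upper right entry vanished, the diagonal entries would be equal to `1` or to `-1`.
  have hb : h 0 1 ≠ 0 := by
    intro hb
    rw [hb, zero_mul, sub_zero] at hdet
    rcases Int.mul_eq_one_iff_eq_one_or_neg_one.1 hdet with ⟨h1, h2⟩ | ⟨h1, h2⟩ <;>
      norm_num [h1, h2] at hdisc
  set a : ℝ := (h 0 0 : ℝ)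
  set b : ℝ := (h 0 1 : ℝ)
  set c : ℝ := (h 1 0 : ℝ)
  set d : ℝ := (h 1 1 : ℝ)
  have hdetR : a * d - b * c = 1 := by simp only [a, b, c, d]; exact_mod_cast hdet
  have hdiscR : 4 < (a + d) ^ 2 := by simp only [a, d]; exact_mod_cast hdisc
  have hbR : b ≠ 0 := by simp only [b]; exact_mod_cast hb
  set δ := Real.sqrt ((a + d) ^ 2 - 4)
  have hδ : 0 < δ := Real.sqrt_pos.2 (by linarith)
  have hδ2 : δ ^ 2 = (a + d) ^ 2 - 4 := Real.sq_sqrt (by linarith)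
  obtain ⟨r, hr⟩ : ∃ r, r = (a + d + δ) / 2 := ⟨_, rfl⟩
  obtain ⟨r', hr'⟩ : ∃ r', r' = (a + d - δ) / 2 := ⟨_, rfl⟩
  have hsum : r + r' = a + d := by rw [hr, hr']; ring
  have hprod : r * r' = 1 := by rw [hr, hr']; linear_combination (-1 / 4) * hδ2
  have hne : r' - r ≠ 0 := by rw [hr, hr']; intro h0; linarith
  -- The columns `(b, r - a)` and `(b, r' - a)` are eigenvectors; the second is rescaled.
  refine ⟨⟨!![b, 1 / (r' - r); r - a, (r' - a) / (b * (r' - r))], ?_⟩,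
    ⟨!![r, 0; 0, r'], by simpa [Matrix.det_fin_two] using hprod⟩, rfl, rfl, ?_, ?_⟩
  · rw [Matrix.det_fin_two_of]; field_simp; ring
  · intro h0; exact hne (sub_eq_zero.2 h0.symm)
  · apply Subtype.ext
    have hm : ((Matrix.SpecialLinearGroup.map (Int.castRingHom ℝ) h : SL(2, ℝ)) :
        Matrix (Fin 2) (Fin 2) ℝ) = !![a, b; c, d] := by
      ext i j; fin_cases i <;> fin_cases j <;> rfl
    change (Matrix.SpecialLinearGroup.map (Int.castRingHom ℝ) h :
      Matrix (Fin 2) (Fin 2) ℝ) * !![b, 1 / (r' - r); r - a, (r' - a) / (b * (r' - r))] =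
      !![b, 1 / (r' - r); r - a, (r' - a) / (b * (r' - r))] * !![r, 0; 0, r']
    rw [hm, Matrix.mul_fin_two, Matrix.mul_fin_two]
    have e1 : c * b + d * (r - a) = (r - a) * r := by
      linear_combination -hdetR - r * hsum + hprod
    have e2 : c * b + d * (r' - a) = (r' - a) * r' := by
      linear_combination -hdetR - r' * hsum + hprod
    congr 1
    ext i j
    fin_cases i <;> fin_cases j
    · simp; ring
    · simp; field_simp; ring
    · simp; linear_combination e1
    · simp; field_simp; linear_combination e2

/-- For `n` even all weights `n - 1 - 2i` of the representation are odd, hence nonzero, so that no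
eigenvalue of a hyperbolic element on the binary forms of degree `n - 1` has absolute value `1`. In
an eigenbasis, two powers of the element can therefore agree only on the zero covector. -/
theorem infinite_dual_orbit_of_isHyperbolic (hn : Even n) {h : SL(2, ℤ)}
    (hh : (h : Matrix (Fin 2) (Fin 2) ℤ).IsHyperbolic) {k : Fin n → ℤ} (hk : k ≠ 0) :
    ((fun A => k ᵥ* A) '' Set.range fun m : ℕ => repMatrix ℤ n (h ^ m)).Infinite := by
  intro hfin
  apply hk
  have := hfin.to_subtype
  obtain ⟨s, t, hst, heq⟩ := Finite.exists_ne_map_eq_of_infinite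
    (fun m : ℕ => (⟨k ᵥ* repMatrix ℤ n (h ^ m), _, ⟨m, rfl⟩, rfl⟩ :
      ((fun A => k ᵥ* A) '' Set.range fun m : ℕ => repMatrix ℤ n (h ^ m))))
  have heq' : k ᵥ* repMatrix ℤ n (h ^ s) = k ᵥ* repMatrix ℤ n (h ^ t) := congrArg Subtype.val heq
  obtain ⟨p, q, hq01, hq10, hne, hpq⟩ := exists_diagonalization_of_isHyperbolic hh
  set H := Matrix.SpecialLinearGroup.map (Int.castRingHom ℝ) h
  have hprod : q 0 0 * q 1 1 = 1 := by
    have := q.det_coe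
    rwa [Matrix.det_fin_two, hq01, zero_mul, sub_zero] at this
  have h0 : q 0 0 ≠ 0 := left_ne_zero_of_mul_eq_one hprod
  have h1 : q 1 1 ≠ 0 := right_ne_zero_of_mul_eq_one hprod
  have hlogsum : Real.log (q 0 0) + Real.log (q 1 1) = 0 := by
    rw [← Real.log_mul h0 h1, hprod, Real.log_one]
  -- `Real.log` is the logarithm of the absolute value, so this says `|q 0 0| ≠ 1`.
  have hlog : Real.log (q 0 0) ≠ 0 := by
    intro hl
    rcases Real.log_eq_zero.1 hl with h' | h' | h'
    · exact h0 h'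
    · rw [h', one_mul] at hprod
      exact hne (h'.trans hprod.symm)
    · rw [h'] at hprod
      exact hne (by linarith)
  let kR : Fin n → ℝ := fun i => (k i : ℝ)
  have hcast : ∀ m : ℕ, kR ᵥ* repMatrix ℝ n (H ^ m) =
      fun i => (((k ᵥ* repMatrix ℤ n (h ^ m)) i : ℤ) : ℝ) := by
    intro m
    rw [← map_pow, repMatrix_map]
    funext i
    simp [Matrix.vecMul, dotProduct, kR]
  have hHp : ∀ m : ℕ, H ^ m * p = p * q ^ m := by
    intro m
    exact (show SemiconjBy p q H from hpq.symm).pow_right m |>.eq.symm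
  have hR : (kR ᵥ* repMatrix ℝ n p) ᵥ* repMatrix ℝ n (q ^ s) =
      (kR ᵥ* repMatrix ℝ n p) ᵥ* repMatrix ℝ n (q ^ t) := by
    rw [Matrix.vecMul_vecMul, Matrix.vecMul_vecMul, ← repMatrix_mul, ← repMatrix_mul, ← hHp,
      ← hHp, repMatrix_mul, repMatrix_mul, ← Matrix.vecMul_vecMul, ← Matrix.vecMul_vecMul,
      hcast, hcast, heq']
  have hz : kR ᵥ* repMatrix ℝ n p = 0 := by
    funext i
    have hi := congrFun hR i
    rw [repMatrix_pow, repMatrix_pow, repMatrix_of_diagonal hq01 hq10, Matrix.diagonal_pow,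
      Matrix.diagonal_pow, Matrix.vecMul_diagonal, Matrix.vecMul_diagonal] at hi
    by_contra hzi
    have hpow := mul_left_cancel₀ hzi hi
    have hl := congrArg Real.log hpow
    simp only [Pi.pow_apply] at hl
    rw [Real.log_pow, Real.log_pow, Real.log_mul (pow_ne_zero _ h0) (pow_ne_zero _ h1),
      Real.log_pow, Real.log_pow] at hl
    obtain ⟨m, hm⟩ := hn
    have hle : (i : ℕ) ≤ n - 1 := by omega
    have hw : ((n - 1 - (i : ℕ) : ℕ) : ℝ) - (i : ℕ) ≠ 0 := by
      rw [sub_ne_zero]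
      have : n - 1 - (i : ℕ) ≠ i := by omega
      exact_mod_cast this
    have hl' : ((s : ℝ) - t) *
        ((((n - 1 - (i : ℕ) : ℕ) : ℝ) - (i : ℕ)) * Real.log (q 0 0)) = 0 := by
      linear_combination hl - ((s : ℝ) - t) * (i : ℕ) * hlogsum
    have hst' : (s : ℝ) - t ≠ 0 := sub_ne_zero.2 (by exact_mod_cast hst)
    exact mul_ne_zero hst' (mul_ne_zero hw hlog) hl'
  have hkR : kR = 0 := by
    have h2 : kR = (kR ᵥ* repMatrix ℝ n p) ᵥ* repMatrix ℝ n p⁻¹ := by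
      rw [Matrix.vecMul_vecMul, ← repMatrix_mul, mul_inv_cancel, repMatrix_one, Matrix.vecMul_one]
    rw [h2, hz, Matrix.zero_vecMul]
  funext i
  exact Int.cast_injective ((congrFun hkR i).trans Int.cast_zero.symm)

theorem countable_specialLinearGroup_int : Countable SL(2, ℤ) :=
  have : Countable (Matrix (Fin 2) (Fin 2) ℤ) := inferInstanceAs (Countable (Fin 2 → Fin 2 → ℤ))
  Subtype.countable

end BinaryForm

open BinaryForm

/-! ### Ergodicity and essential freeness -/

theorem mainTheorem1 (n : ℕ) [NeZero n] (hn : 2 ≤ n) :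
    (Even n →
      ErgodicSMul SL(2, ℤ) (UnitAddTorus (Fin n)) (volume : Measure (UnitAddTorus (Fin n))) ∧
      EssentiallyFree SL(2, ℤ) (volume : Measure (UnitAddTorus (Fin n)))) ∧
    (∀ _ : Fact (Odd n),
      ErgodicSMul PSL(2, ℤ) (UnitAddTorus (Fin n))
        (volume : Measure (UnitAddTorus (Fin n))) ∧
      EssentiallyFree PSL(2, ℤ)
        (volume : Measure (UnitAddTorus (Fin n)))) ∧
    (Even n → ∀ h : SL(2, ℤ), (h : Matrix (Fin 2) (Fin 2) ℤ).IsHyperbolic →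
      ErgodicSMul (Subgroup.zpowers h) (UnitAddTorus (Fin n))
        (volume : Measure (UnitAddTorus (Fin n)))) := by
  have hcount := countable_specialLinearGroup_int
  refine ⟨fun hev => ⟨?_, ?_⟩, fun hodd => ⟨?_, ?_⟩, fun hev h hh => ?_⟩
  · refine ergodicSMul_of_infinite_dual_orbits (fun g => ⟨repMatrix ℤ n g, fun x => rfl⟩)
      (Set.range (repMatrix ℤ n)) ?_ fun k hk => infinite_dual_orbit_specialLinearGroup hn hk
    rintro _ ⟨g, rfl⟩
    exact ⟨g, fun x => rfl⟩
  · refine essentiallyFree_of_toralMap fun g hg => ⟨repMatrix ℤ n g, fun h1 => hg ?_, fun x => rfl⟩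
    obtain ⟨h01, h10, h00, h11⟩ := entries_of_repMatrix_eq_one hn h1
    have hN : Odd (n - 1) := by
      obtain ⟨m, hm⟩ := hev
      exact ⟨m - 1, by omega⟩
    have hone : ∀ z : ℤ, z ^ (n - 1) = 1 → z = 1 := fun z hz =>
      hN.strictMono_pow.injective (hz.trans (one_pow _).symm)
    ext i j
    fin_cases i <;> fin_cases j
    · simpa using hone _ h00
    · simpa using h01
    · simpa using h10
    · simpa using hone _ h11
  · refine ergodicSMul_of_infinite_dual_orbits (fun g => ?_)
      (Set.range (repMatrix ℤ n)) ?_ fun k hk => infinite_dual_orbit_specialLinearGroup hn hk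
    · obtain ⟨g, rfl⟩ := QuotientGroup.mk_surjective g
      exact ⟨repMatrix ℤ n g, fun x => rfl⟩
    · rintro _ ⟨g, rfl⟩
      exact ⟨(g : PSL(2, ℤ)), fun x => rfl⟩
  · have : Countable PSL(2, ℤ) := Quotient.countable
    refine essentiallyFree_of_toralMap fun g hg => ?_
    obtain ⟨g, rfl⟩ := QuotientGroup.mk_surjective g
    refine ⟨repMatrix ℤ n g, fun h1 => hg ?_, fun x => rfl⟩
    obtain ⟨h01, h10, h00, h11⟩ := entries_of_repMatrix_eq_one hn h1
    have hdet : g 0 0 * g 1 1 = 1 := by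
      have := g.det_coe
      rwa [Matrix.det_fin_two, h01, zero_mul, sub_zero] at this
    refine (QuotientGroup.eq_one_iff g).2 (Matrix.SpecialLinearGroup.mem_center_iff.2
      ⟨g 0 0, ?_, ?_⟩)
    · rcases Int.mul_eq_one_iff_eq_one_or_neg_one.1 hdet with ⟨h, -⟩ | ⟨h, -⟩ <;> simp [h]
    · have hd : g 1 1 = g 0 0 := by
        rcases Int.mul_eq_one_iff_eq_one_or_neg_one.1 hdet with ⟨h, h'⟩ | ⟨h, h'⟩ <;> rw [h, h']
      rw [Matrix.scalar_apply]
      ext i j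
      fin_cases i <;> fin_cases j
      · simp
      · simpa using h01.symm
      · simpa using h10.symm
      · simpa using hd.symm
  · refine ergodicSMul_of_infinite_dual_orbits (fun g => ⟨repMatrix ℤ n g, fun x => rfl⟩)
      (Set.range fun m : ℕ => repMatrix ℤ n (h ^ m)) ?_
      fun k hk => infinite_dual_orbit_of_isHyperbolic hev hh hk
    rintro _ ⟨m, rfl⟩
    exact ⟨⟨h ^ m, Subgroup.npow_mem_zpowers h m⟩, fun x => rfl⟩
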